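/- For an element $s$ of a finite semigroup, let $s^\omega$ denote the unique idempotent among the powers $s^n$ ($n\ge 1$), and put $s^{\omega+1}=s^\omega s$. Let $\mathsf V_1=[\![(exf)^{\omega+1}=exf]\!]$ be the pseudovariety of all finite semigroups $S$ such that $(exf)^{\omega+1}=exf$ for all $t,x,z\in S$, where $e=t^\omega$ and $f=z^\omega$ (that is, for all idempotents $e,f\in S$ and all $x\in S$). For a subsemigroup $U$ of a semigroup $S$, the dominion $\mathrm{Dom}(U,S)$ is the set of all $d\in S$ such that $d\alpha=d\beta$ for every semigroup $T$ and all homomorphisms $\alpha,\beta:S\to T$ that agree on $U$. A semigroup $U$ is saturated if $\mathrm{Dom}(U,S)\neq S$ for every semigroup $S$, finite or infinite, that properly contains $U$ as a subsemigroup. Theorem. (1) $\mathsf V_1$ is saturated: every member of $\mathsf V_1$ is a saturated semigroup. (2) $\mathsf V_1$ is epimorphically closed: if $S\in\mathsf V_1$ and $\alpha:S\to T$ is an epimorphism in the category of all semigroups (with $T$ finite or infinite), then $T\in\mathsf V_1$. -/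

import Mathlib

universe u

namespace SemigroupEpi

/-- The positive powers of an element of a semigroup: `spow s n` is `s ^ (n + 1)`. -/
def spow {S : Type u} [Semigroup S] (s : S) : ℕ → S
  | 0 => s
  | n + 1 => spow s n * s

theorem spow_mul_spow {S : Type u} [Semigroup S] (s : S) (m n : ℕ) :
    spow s m * spow s n = spow s (m + n + 1) := by
  induction n with
  | zero => rfl
  | succ n ih =>
    change spow s m * (spow s n * s) = spow s (m + n + 1) * s
    rw [← mul_assoc, ih]

theorem spow_of_idem {S : Type u} [Semigroup S] {s : S} {m : ℕ}
    (h : IsIdempotentElem (spow s m)) (k : ℕ) :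
    spow s ((m + 1) * (k + 1) - 1) = spow s m := by
  induction k with
  | zero => simp
  | succ k ih =>
    have h1 : (m + 1) * (k + 1 + 1) - 1 = ((m + 1) * (k + 1) - 1) + m + 1 := by
      have : 0 < (m + 1) * (k + 1) := by positivity
      rw [Nat.mul_succ]
      omega
    rw [h1, ← spow_mul_spow, ih, h.eq]

/-- Every element of a finite semigroup has exactly one idempotent power. -/
theorem existsUnique_idem_power {S : Type u} [Semigroup S] [Finite S] (s : S) :
    ∃! e : S, IsIdempotentElem e ∧ ∃ n : ℕ, e = spow s n := by
  obtain ⟨i, d, hd, hid⟩ : ∃ i d : ℕ, 0 < d ∧ spow s (i + d) = spow s i := by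
    obtain ⟨a, b, hab, h⟩ := Finite.exists_ne_map_eq_of_infinite (spow s)
    rcases lt_or_gt_of_ne hab with hlt | hlt
    · exact ⟨a, b - a, by omega, by rw [Nat.add_sub_cancel' hlt.le, h]⟩
    · exact ⟨b, a - b, by omega, by rw [Nat.add_sub_cancel' hlt.le, h]⟩
  have h1 : ∀ r : ℕ, spow s (i + r + d) = spow s (i + r) := by
    intro r
    induction r with
    | zero => exact hid
    | succ r ih =>
      have h2 : i + (r + 1) + d = (i + r + d) + 1 := by omega
      rw [h2]
      change spow s (i + r + d) * s = spow s (i + r) * s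
      rw [ih]
  have h2 : ∀ k r : ℕ, spow s (i + r + k * d) = spow s (i + r) := by
    intro k
    induction k with
    | zero => intro r; simp
    | succ k ih =>
      intro r
      have h3 : i + r + (k + 1) * d = i + (r + k * d) + d := by ring
      rw [h3, h1, ← add_assoc, ih]
  have hle : i + 1 ≤ (i + 1) * d := Nat.le_mul_of_pos_right _ hd
  obtain ⟨r, hr⟩ : ∃ r, (i + 1) * d = i + r + 1 := ⟨(i + 1) * d - (i + 1), by omega⟩
  refine ⟨spow s (i + r), ⟨?_, _, rfl⟩, ?_⟩
  · change spow s (i + r) * spow s (i + r) = spow s (i + r)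
    rw [spow_mul_spow]
    have h4 : i + r + (i + r) + 1 = i + r + (i + 1) * d := by omega
    rw [h4, h2]
  · have hidem : IsIdempotentElem (spow s (i + r)) := by
      change spow s (i + r) * spow s (i + r) = spow s (i + r)
      rw [spow_mul_spow]
      have h4 : i + r + (i + r) + 1 = i + r + (i + 1) * d := by omega
      rw [h4, h2]
    rintro e ⟨he, n, rfl⟩
    rw [← spow_of_idem he (i + r), ← spow_of_idem hidem n, mul_comm]

/-- The `ω`-power `s ^ ω` of an element of a finite semigroup: its only idempotent power. -/
noncomputable def omegaPow {S : Type u} [Semigroup S] [Finite S] (s : S) : S :=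
  (existsUnique_idem_power s).choose

/-- The class `⟦(exf)^{ω+1} = exf⟧` of finite semigroups, where `e = t ^ ω` and `f = z ^ ω`, and
where `w ^ (ω + 1)` is `w ^ ω * w`. -/
def V1 (S : Semigrp.{u}) : Prop :=
  ∃ _ : Finite S, ∀ t x z : S,
    omegaPow (omegaPow t * x * omegaPow z) * (omegaPow t * x * omegaPow z) =
      omegaPow t * x * omegaPow z

/-- The dominion of a subsemigroup `U` in a semigroup `S`. -/
def dominion {S : Type u} [Semigroup S] (U : Subsemigroup S) : Set S :=
  {d | ∀ (T : Type u) [Semigroup T] (α β : S →ₙ* T), (∀ x ∈ U, α x = β x) → α d = β d}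

/-- `U` is saturated if it is not properly epimorphically embedded in any semigroup `S`, finite or
infinite. Embeddings of `U` in `S` are injective homomorphisms. -/
def IsSaturated (U : Semigrp.{u}) : Prop :=
  ∀ (S : Type u) [Semigroup S] (φ : U →ₙ* S), Function.Injective φ →
    φ.srange ≠ ⊤ → dominion φ.srange ≠ Set.univ

/-- A class of semigroups is saturated if each of its members is. -/
def IsSaturatedClass (C : Semigrp.{u} → Prop) : Prop :=
  ∀ U : Semigrp.{u}, C U → IsSaturated U

/-- A class of semigroups is epimorphically closed if it contains the codomain of every epimorphism
(of the category of all semigroups) whose domain it contains. -/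
def IsEpimorphicallyClosed (C : Semigrp.{u} → Prop) : Prop :=
  ∀ (S T : Semigrp.{u}) (α : S ⟶ T), CategoryTheory.Epi α → C S → C T

end SemigroupEpi

/-!
Let `φ : U → S` be a morphism from a finite semigroup whose image has dominion `S`. By Isbell's
zigzags, every `d` outside the image is `x * φ c * y` with `y` outside the image and `φ c * y`
inside it. As `U` is finite, `x` and `y` can be trimmed so that `c` starts with an idempotent and
`y` is fixed from the left by an idempotent `f` of `U`; then `c` can be chosen in `e * U * f` and is
completely regular, so it has an idempotent `h` in its subgroup. It satisfies `h <_𝓙 f`, since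
otherwise stability would put `y` into the image. If `d` is moreover fixed from the right by an
idempotent, then it is fixed by one that is at most `h` in the `𝓙`-order. So the idempotents that
fix `d` from the right reach strictly lower than those that fix `y` from the left, and alternating
between left and right gives infinite descent in a finite semigroup.
-/

open CategoryTheory Function MulOpposite

namespace SemigroupEpi

section Dominion

variable {S : Type u} [Semigroup S] {U : Subsemigroup S} {d : S}

theorem commute_of_mem_dominion (hd : d ∈ dominion U) {T : Type u} [Monoid T] (ι : S →ₙ* T)
    (g : Tˣ) (hg : ∀ u ∈ U, Commute (g : T) (ι u)) : Commute (g : T) (ι d) := by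
  let conj : T →* T := MulDistribMulAction.toMonoidHom T (ConjAct.toConjAct g)
  have conj_eq_iff (t : T) : conj t = t ↔ Commute (g : T) t := by
    change (g : T) * t * (g⁻¹ : Tˣ) = t ↔ _
    rw [Units.mul_inv_eq_iff_eq_mul]
    exact Iff.rfl
  have hfix : (conj : T →ₙ* T).comp ι d = ι d :=
    hd T _ ι fun u hu => (conj_eq_iff _).2 (hg u hu)
  exact (conj_eq_iff _).1 hfix

variable {X : Type u} [MulAction (WithOne S) X]

open Classical in
/-- The action of `S` on `X × ℤ` that forgets the integer label on leaving `D`. It is associative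
because points outside `D` never return to `D`. -/
noncomputable def labelledAction (D : Set X)
    (hD : ∀ (s : S) (x : X), (s : WithOne S) • x ∈ D → x ∈ D) : S →ₙ* Function.End (X × ℤ) where
  toFun s p := ((s : WithOne S) • p.1, if (s : WithOne S) • p.1 ∈ D then p.2 else 0)
  map_mul' s t := by
    funext ⟨x, n⟩
    have := hD s ((t : WithOne S) • x)
    change (((s * t : S) : WithOne S) • x, if ((s * t : S) : WithOne S) • x ∈ D then n else 0) =
      ((s : WithOne S) • (t : WithOne S) • x, if (s : WithOne S) • (t : WithOne S) • x ∈ D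
        then (if (t : WithOne S) • x ∈ D then n else 0) else 0)
    grind [WithOne.coe_mul, mul_smul]

open Classical in
theorem labelledAction_apply {D : Set X} (hD : ∀ (s : S) (x : X), (s : WithOne S) • x ∈ D → x ∈ D)
    (s : S) (x : X) (n : ℤ) : labelledAction D hD s (x, n) =
      ((s : WithOne S) • x, if (s : WithOne S) • x ∈ D then n else 0) :=
  rfl

open Classical in
/-- The permutation of `X × ℤ` that raises the labels of the points of `A` by one. -/
noncomputable def labelShift {X : Type*} (A : Set X) : Equiv.Perm (X × ℤ) :=
  Equiv.prodShear (Equiv.refl X) fun x => Equiv.addRight (if x ∈ A then 1 else 0)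

open Classical in
theorem labelShift_apply {X : Type*} (A : Set X) (x : X) (n : ℤ) :
    labelShift A (x, n) = (x, n + if x ∈ A then 1 else 0) :=
  rfl

/-- Labels can be shifted on `A ∩ D` in a way that commutes with `U`, hence with its dominion. -/
theorem smul_mem_iff_of_mem_dominion {D A : Set X} (hd : d ∈ dominion U)
    (hD : ∀ (s : S) (x : X), (s : WithOne S) • x ∈ D → x ∈ D)
    (hA : ∀ u ∈ U, ∀ x : X, (u : WithOne S) • x ∈ D → ((u : WithOne S) • x ∈ A ↔ x ∈ A))
    {x : X} (hx : (d : WithOne S) • x ∈ D) : (d : WithOne S) • x ∈ A ↔ x ∈ A := by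
  have hcomm := commute_of_mem_dominion hd (labelledAction D hD)
    (Equiv.Perm.equivUnitsEnd (labelShift (A ∩ D))) fun u hu => by
      funext ⟨x, n⟩
      have := hA u hu x
      have := hD u x
      change labelShift (A ∩ D) (labelledAction D hD u (x, n)) =
        labelledAction D hD u (labelShift (A ∩ D) (x, n))
      simp only [labelShift_apply, labelledAction_apply, Set.mem_inter_iff]
      grind
  have hlabel : labelShift (A ∩ D) (labelledAction D hD d (x, 0)) =
      labelledAction D hD d (labelShift (A ∩ D) (x, 0)) := congrFun hcomm (x, 0)
  have := hD d x hx
  simp only [labelShift_apply, labelledAction_apply, Set.mem_inter_iff] at hlabel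
  grind

/-- The step `(x * a, y) ↦ (x, a * y)` at which the right factor of a zigzag for `d` enters `U`. -/
theorem exists_zigzag_step_of_mem_dominion (hd : d ∈ dominion U) (hdU : d ∉ U) :
    ∃ x, ∃ a ∈ U, ∃ y ∉ U, a * y ∈ U ∧ x * (a * y) = d := by
  by_contra! hstep
  let D : Set (WithOne S) := {q | ∃ p, p * q = d}
  let A : Set (WithOne S) := insert 1 ((↑) '' (U : Set S))
  have coe_mem_A (s : S) : (s : WithOne S) ∈ A ↔ s ∈ U := by
    simp [A, WithOne.coe_ne_one]
  have hD (s : S) (q : WithOne S) : (s : WithOne S) • q ∈ D → q ∈ D :=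
    fun ⟨p, hp⟩ => ⟨p * s, by rw [mul_assoc]; exact hp⟩
  have hA : ∀ u ∈ U, ∀ q : WithOne S,
      (u : WithOne S) • q ∈ D → ((u : WithOne S) • q ∈ A ↔ q ∈ A) := by
    rintro u hu q ⟨p, hp⟩
    induction q using WithOne.recOneCoe with
    | one => simpa [A] using hu
    | coe y =>
      rw [smul_eq_mul, ← WithOne.coe_mul] at hp ⊢
      rw [coe_mem_A, coe_mem_A]
      refine ⟨fun huy => ?_, U.mul_mem hu⟩
      by_contra hy
      induction p using WithOne.recOneCoe with
      | one => exact hdU (WithOne.coe_inj.1 ((one_mul _).symm.trans hp) ▸ huy)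
      | coe x => exact hstep x u hu y hy huy (WithOne.coe_inj.1 hp)
  have hd1 : (d : WithOne S) • (1 : WithOne S) ∈ A :=
    (smul_mem_iff_of_mem_dominion hd hD hA ⟨1, by simp⟩).2 (Set.mem_insert _ _)
  rw [smul_eq_mul, mul_one, coe_mem_A] at hd1
  exact hdU hd1

theorem op_mem_dominion_op (hd : d ∈ dominion U) : op d ∈ dominion U.op := by
  intro T _ α β hαβ
  let flip (γ : Sᵐᵒᵖ →ₙ* T) : S →ₙ* Tᵐᵒᵖ :=
    (MulHom.op γ).comp (MulEquiv.opOp S : S →ₙ* Sᵐᵒᵖᵐᵒᵖ)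
  exact op_injective (hd Tᵐᵒᵖ (flip α) (flip β) fun u hu => congrArg op (hαβ (op u) hu))

end Dominion

section FiniteSemigroup

variable {S : Type*} [Semigroup S]

theorem exists_isIdempotentElem_mem [Finite S] {W : Subsemigroup S} (hW : (W : Set S).Nonempty) :
    ∃ e ∈ W, IsIdempotentElem e := by
  obtain ⟨w, hw⟩ := hW
  obtain ⟨e, ⟨he, -⟩, -⟩ := existsUnique_idem_power (⟨w, hw⟩ : W)
  exact ⟨e, e.2, he.map (MulMemClass.subtype W)⟩

theorem exists_isIdempotentElem_mul_eq [Finite S] {z b : S} (hz : z * b = b) :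
    ∃ e, IsIdempotentElem e ∧ e * b = b := by
  let W : Subsemigroup S :=
    { carrier := {w | w * b = b}
      mul_mem' := fun {v w} (hv : v * b = b) (hw : w * b = b) =>
        (by rw [mul_assoc, hw, hv] : v * w * b = b) }
  obtain ⟨e, heb, he⟩ := exists_isIdempotentElem_mem (W := W) ⟨z, hz⟩
  exact ⟨e, he, heb⟩

/-- Stability of finite semigroups: `𝓛`-comparable elements that are `𝓙`-equivalent are
`𝓛`-equivalent. -/
theorem mul_eq_of_eq_mul_mul [Finite S] {f h p q : S} (hh : IsIdempotentElem h)
    (hhf : h * f = h) (hf : p * h * q = f) : f * h = f := by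
  let W : Subsemigroup S :=
    { carrier := {w | w * h = w ∧ ∃ r, w * r = f}
      mul_mem' := by
        rintro v w ⟨hvh, r, hvr⟩ ⟨hwh, s, hws⟩
        have hvf : v * f = v := by rw [← hvh, mul_assoc, hhf]
        refine ⟨by rw [mul_assoc, hwh], s * r, ?_⟩
        rw [mul_assoc, ← mul_assoc w, hws, ← mul_assoc, hvf, hvr] }
  obtain ⟨w, ⟨hwh, r, hr⟩, hw⟩ := exists_isIdempotentElem_mem (W := W)
    ⟨p * h, by rw [mul_assoc, hh.eq], q, hf⟩
  have hwf : w * f = f := by rw [← hr, ← mul_assoc, hw.eq]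
  have hfw : f = w := by rw [← hwf, ← hwh, mul_assoc, hhf]
  rw [hfw, hwh]

/-- The number of two-sided multiples of `s`, a rank for the `𝓙`-order. No unit is adjoined, so `s`
itself is certain to be counted only if it is regular. -/
noncomputable def jRank (s : S) : ℕ :=
  {t | ∃ p q, p * s * q = t}.ncard

theorem jRank_le_card [Finite S] (s : S) : jRank s ≤ Nat.card S :=
  Set.ncard_le_card _

theorem jRank_mul_mul_le [Finite S] (p s q : S) : jRank (p * s * q) ≤ jRank s := by
  refine Set.ncard_le_ncard ?_
  rintro _ ⟨p', q', rfl⟩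
  exact ⟨p' * p, q * q', by simp only [mul_assoc]⟩

theorem jRank_lt_jRank [Finite S] {f h : S} (hf : IsIdempotentElem f) (hh : IsIdempotentElem h)
    (hhf : h * f = h) (hfh : f * h ≠ f) : jRank h < jRank f := by
  refine Set.ncard_lt_ncard ⟨?_, fun hsub => ?_⟩
  · rintro _ ⟨p, q, rfl⟩
    exact ⟨p * h, q, by rw [mul_assoc p, hhf]⟩
  · obtain ⟨p, q, hpq⟩ := hsub ⟨f, f, by rw [hf.eq, hf.eq]⟩
    exact hfh (mul_eq_of_eq_mul_mul hh hhf hpq)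

theorem jRank_op (s : S) : jRank (op s) = jRank s := by
  rw [jRank, jRank, ← Set.ncard_image_of_injective {t | ∃ p q, p * s * q = t} op_injective]
  congr 1
  ext t
  constructor
  · rintro ⟨p, q, rfl⟩
    exact ⟨_, ⟨q.unop, p.unop, rfl⟩, unop_injective (by simp only [unop_mul, unop_op, mul_assoc])⟩
  · rintro ⟨_, ⟨p, q, rfl⟩, rfl⟩
    exact ⟨op q, op p, by simp only [op_mul, mul_assoc]⟩

/-- An element of a semigroup is completely regular if it has a commuting inverse, that is, if it
lies in a subgroup. -/
def IsCompletelyRegular (c : S) : Prop :=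
  ∃ v, c * v * c = c ∧ c * v = v * c

variable (S) in
/-- The semigroups in which `e * x * f` is completely regular for all idempotents `e` and `f`; the
finite ones are the members of `V1`. -/
def IsSandwichRegular : Prop :=
  ∀ e x f : S, IsIdempotentElem e → IsIdempotentElem f → IsCompletelyRegular (e * x * f)

theorem IsCompletelyRegular.op {c : S} (hc : IsCompletelyRegular c) :
    IsCompletelyRegular (op c) := by
  obtain ⟨v, hcvc, hcv⟩ := hc
  refine ⟨MulOpposite.op v, unop_injective ?_, unop_injective hcv.symm⟩
  simpa only [unop_mul, unop_op, mul_assoc] using hcvc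

theorem IsSandwichRegular.op (hS : IsSandwichRegular S) : IsSandwichRegular Sᵐᵒᵖ := by
  intro e x f he hf
  simpa only [op_mul, op_unop, mul_assoc] using
    (hS f.unop x.unop e.unop (congrArg unop hf) (congrArg unop he)).op

end FiniteSemigroup

section Epimorphism

variable {U : Type*} {S : Type u} [Semigroup U] [Semigroup S] {φ : U →ₙ* S}

theorem dominion_srange_op_eq_univ (hφ : dominion φ.srange = Set.univ) :
    dominion (MulHom.op φ).srange = Set.univ := by
  have hop : (MulHom.op φ).srange = φ.srange.op := by
    ext s
    exact ⟨fun ⟨u, hu⟩ => ⟨u.unop, congrArg unop hu⟩, fun ⟨u, hu⟩ => ⟨op u, congrArg op hu⟩⟩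
  rw [hop]
  exact Set.eq_univ_of_forall fun d =>
    op_mem_dominion_op (hφ ▸ Set.mem_univ d.unop : d.unop ∈ dominion φ.srange)

theorem notMem_srange_op {d : S} (hd : d ∉ φ.srange) : op d ∉ (MulHom.op φ).srange :=
  fun ⟨u, hu⟩ => hd ⟨u.unop, congrArg unop hu⟩

theorem notMem_srange_of_mul_map {x : S} {u : U} (h : x * φ u ∉ φ.srange) : x ∉ φ.srange :=
  fun hx => h (φ.srange.mul_mem hx ⟨u, rfl⟩)

theorem notMem_srange_of_map_mul {x : S} {u : U} (h : φ u * x ∉ φ.srange) : x ∉ φ.srange :=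
  fun hx => h (φ.srange.mul_mem ⟨u, rfl⟩ hx)

theorem exists_zigzag_step (hφ : dominion φ.srange = Set.univ) {d : S} (hd : d ∉ φ.srange) :
    ∃ x y a b, y ∉ φ.srange ∧ φ a * y = φ b ∧ x * φ b = d := by
  obtain ⟨x, _, ⟨a, rfl⟩, y, hy, ⟨b, hb⟩, hd⟩ :=
    exists_zigzag_step_of_mem_dominion (hφ ▸ Set.mem_univ d) hd
  exact ⟨x, y, a, b, hy, hb.symm, by rw [hb, hd]⟩

/-- Factoring `d` repeatedly as `x * φ b` makes the left ideals generated by `b` stabilize. -/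
theorem exists_eq_mul_map_idempotent_mul [Finite U] (hφ : dominion φ.srange = Set.univ) {d : S}
    (hd : d ∉ φ.srange) : ∃ x e u, IsIdempotentElem e ∧ x * φ (e * u) = d := by
  have hfactor {d : S} (hd : d ∉ φ.srange) : ∃ x b, x * φ b = d :=
    let ⟨x, _, _, b, _, _, hb⟩ := exists_zigzag_step hφ hd
    ⟨x, b, hb⟩
  obtain ⟨b, ⟨x, hx⟩, hmin⟩ := exists_minimalFor_of_wellFoundedLT (fun b => ∃ x, x * φ b = d)
    (fun b => Set.range (· * b)) (let ⟨x, b, hb⟩ := hfactor hd; ⟨b, x, hb⟩)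
  obtain ⟨x', a, rfl⟩ := hfactor (notMem_srange_of_mul_map (hx ▸ hd))
  have hab : x' * φ (a * b) = d := by rw [map_mul, ← mul_assoc, hx]
  have hle : Set.range (· * b) ⊆ Set.range (· * (a * b)) := by
    refine hmin ⟨x', hab⟩ ?_
    rintro _ ⟨z, rfl⟩
    exact ⟨z * a, mul_assoc z a b⟩
  obtain ⟨z, hz⟩ := hle ⟨a, rfl⟩
  obtain ⟨e, he, heab⟩ := exists_isIdempotentElem_mul_eq hz
  exact ⟨x', e, a * b, he, by rw [heab, hab]⟩

theorem exists_eq_map_mul_idempotent_mul [Finite U] (hφ : dominion φ.srange = Set.univ) {d : S}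
    (hd : d ∉ φ.srange) : ∃ v f y, IsIdempotentElem f ∧ φ (v * f) * y = d := by
  have : Finite Uᵐᵒᵖ := .of_equiv U opEquiv
  obtain ⟨y, f, v, hf, h⟩ :=
    exists_eq_mul_map_idempotent_mul (dominion_srange_op_eq_univ hφ) (notMem_srange_op hd)
  exact ⟨v.unop, f.unop, y.unop, congrArg unop hf, congrArg unop h⟩

variable (φ) in
/-- The idempotents of `U` that fix `t` from the left. -/
def leftIdempotents (t : S) : Set U :=
  {g | IsIdempotentElem g ∧ φ g * t = t}

variable (φ) in
/-- The idempotents of `U` that fix `t` from the right. -/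
def rightIdempotents (t : S) : Set U :=
  {g | IsIdempotentElem g ∧ t * φ g = t}

/-- The step `(x * φ a, y) ↦ (x, φ a * y)` of a zigzag, trimmed by idempotents. -/
theorem exists_idempotent_zigzag_step [Finite U] (hφ : dominion φ.srange = Set.univ) {d : S}
    (hd : d ∉ φ.srange) : ∃ x y e c m, IsIdempotentElem e ∧ y ∉ φ.srange ∧
      (leftIdempotents φ y).Nonempty ∧ φ (e * c) * y = φ m ∧ x * φ m = d := by
  obtain ⟨x, y, a, b, hy, hab, hxb⟩ := exists_zigzag_step hφ hd
  have hx : x ∉ φ.srange := notMem_srange_of_mul_map (hxb ▸ hd)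
  obtain ⟨x', e, u, he, rfl⟩ := exists_eq_mul_map_idempotent_mul hφ hx
  obtain ⟨v, f, y', hf, rfl⟩ := exists_eq_map_mul_idempotent_mul hφ hy
  refine ⟨x', φ f * y', e, u * a * v, e * u * b, he, ?_, ⟨f, hf, ?_⟩, ?_, ?_⟩
  · rw [map_mul, mul_assoc] at hy
    exact notMem_srange_of_map_mul hy
  · rw [← mul_assoc, ← map_mul, hf.eq]
  · rw [map_mul φ (e * u), ← hab]
    simp only [map_mul, mul_assoc]
  · rw [map_mul φ (e * u), ← mul_assoc, hxb]

theorem exists_idempotent_jRank_lt [Finite U] {c f m : U} {y : S} (hy : y ∉ φ.srange)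
    (hc : IsCompletelyRegular c) (hf : f ∈ leftIdempotents φ y) (hcf : c * f = c)
    (hcy : φ c * y = φ m) : ∃ h, IsIdempotentElem h ∧ φ (h * m) = φ m ∧ jRank h < jRank f := by
  obtain ⟨v, hcvc, hcv⟩ := hc
  have hv : IsIdempotentElem (c * v) := by rw [IsIdempotentElem, ← mul_assoc, hcvc]
  have hvf : c * v * f = c * v := by rw [hcv, mul_assoc, hcf]
  refine ⟨c * v, hv, by rw [map_mul, ← hcy, ← mul_assoc, ← map_mul, hcvc],
    jRank_lt_jRank hf.1 hv hvf fun hfv => hy ⟨f * v * m, ?_⟩⟩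
  calc φ (f * v * m) = φ (f * (c * v)) * y := by
        rw [map_mul, ← hcy, ← mul_assoc, ← map_mul, hcv, mul_assoc f v c]
    _ = y := by rw [hfv, hf.2]

theorem exists_rightIdempotent_jRank_le [Finite U] (hU : IsSandwichRegular U) {x : S} {h e m : U}
    (hh : IsIdempotentElem h) (he : IsIdempotentElem e) :
    ∃ g ∈ rightIdempotents φ (x * φ (h * m * e)), jRank g ≤ jRank h := by
  obtain ⟨v, hcvc, -⟩ := hU h m e hh he
  refine ⟨v * (h * m * e), ⟨?_, ?_⟩, ?_⟩
  · rw [IsIdempotentElem, mul_assoc, ← mul_assoc (h * m * e), hcvc]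
  · rw [mul_assoc, ← map_mul, ← mul_assoc, hcvc]
  · rw [mul_assoc h, ← mul_assoc v]
    exact jRank_mul_mul_le v h (m * e)

theorem exists_rightIdempotent_jRank_lt [Finite U] (hU : IsSandwichRegular U)
    (hφ : dominion φ.srange = Set.univ) {d : S} (hd : d ∉ φ.srange)
    (hright : (rightIdempotents φ d).Nonempty) :
    ∃ y ∉ φ.srange, (leftIdempotents φ y).Nonempty ∧
      ∀ f ∈ leftIdempotents φ y, ∃ g ∈ rightIdempotents φ d, jRank g < jRank f := by
  obtain ⟨x, y, e, c, m, he, hy, hleft, hcy, rfl⟩ := exists_idempotent_zigzag_step hφ hd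
  refine ⟨y, hy, hleft, fun f hf => ?_⟩
  obtain ⟨e', he', hde'⟩ := hright
  have hcfy : φ (e * c * f) * y = φ m := by rw [map_mul, mul_assoc, hf.2, hcy]
  obtain ⟨h, hh, hhm, hlt⟩ := exists_idempotent_jRank_lt hy (hU e c f he hf.1) hf
    (by rw [mul_assoc, hf.1.eq]) hcfy
  obtain ⟨g, hg, hle⟩ := exists_rightIdempotent_jRank_le (φ := φ) (x := x) (m := m) hU hh he'
  have hd' : x * φ (h * m * e') = x * φ m := by rw [map_mul, hhm, ← mul_assoc, hde']
  exact ⟨g, hd' ▸ hg, hle.trans_lt hlt⟩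

end Epimorphism

/-- Left idempotents are right idempotents of the opposite morphism, so `φ` varies in the
induction. -/
theorem exists_rightIdempotent_jRank_add_le (k : ℕ) {U : Type*} {S : Type u} [Semigroup U]
    [Semigroup S] [Finite U] (hU : IsSandwichRegular U) {φ : U →ₙ* S}
    (hφ : dominion φ.srange = Set.univ) {d : S} (hd : d ∉ φ.srange)
    (hright : (rightIdempotents φ d).Nonempty) :
    ∃ g ∈ rightIdempotents φ d, jRank g + k ≤ Nat.card U := by
  induction k generalizing U S with
  | zero =>
    obtain ⟨e, he⟩ := hright
    exact ⟨e, he, jRank_le_card e⟩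
  | succ k ih =>
    obtain ⟨y, hy, ⟨f, hf, hfy⟩, hlt⟩ := exists_rightIdempotent_jRank_lt hU hφ hd hright
    have : Finite Uᵐᵒᵖ := .of_equiv U opEquiv
    obtain ⟨f', ⟨hf', hfy'⟩, hle⟩ := ih hU.op (dominion_srange_op_eq_univ hφ) (notMem_srange_op hy)
      ⟨op f, congrArg op hf, congrArg op hfy⟩
    obtain ⟨g, hg, hgf⟩ := hlt f'.unop ⟨congrArg unop hf', congrArg unop hfy'⟩
    rw [← op_unop f', jRank_op, Nat.card_congr opEquiv.symm] at hle
    exact ⟨g, hg, by omega⟩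

theorem surjective_of_dominion_srange_eq_univ {U : Type*} {S : Type u} [Semigroup U] [Semigroup S]
    [Finite U] (hU : IsSandwichRegular U) {φ : U →ₙ* S} (hφ : dominion φ.srange = Set.univ) :
    Surjective φ := by
  by_contra hsurj
  obtain ⟨d, hd⟩ : ∃ d, d ∉ φ.srange := by
    simpa only [Surjective, not_forall, MulHom.mem_srange] using hsurj
  obtain ⟨x, e, u, he, rfl⟩ := exists_eq_mul_map_idempotent_mul hφ hd
  rw [map_mul, ← mul_assoc] at hd
  obtain ⟨g, -, hg⟩ := exists_rightIdempotent_jRank_add_le (Nat.card U + 1) hU hφ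
    (notMem_srange_of_mul_map hd) ⟨e, he, by rw [mul_assoc, ← map_mul, he.eq]⟩
  omega

section OmegaPower

variable {S T : Type u} [Semigroup S] [Semigroup T]

theorem map_spow (φ : S →ₙ* T) (s : S) (n : ℕ) :
    φ (spow s n) = spow (φ s) n := by
  induction n with
  | zero => rfl
  | succ n ih => rw [spow, map_mul, ih, spow]

variable [Finite S]

theorem isIdempotentElem_omegaPow (s : S) : IsIdempotentElem (omegaPow s) :=
  (existsUnique_idem_power s).choose_spec.1.1

theorem exists_omegaPow_eq_spow (s : S) : ∃ n, omegaPow s = spow s n :=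
  (existsUnique_idem_power s).choose_spec.1.2

theorem omegaPow_eq {s : S} {n : ℕ} (h : IsIdempotentElem (spow s n)) : omegaPow s = spow s n :=
  ((existsUnique_idem_power s).choose_spec.2 _ ⟨h, n, rfl⟩).symm

theorem map_omegaPow [Finite T] (φ : S →ₙ* T) (s : S) :
    φ (omegaPow s) = omegaPow (φ s) := by
  obtain ⟨n, hn⟩ := exists_omegaPow_eq_spow s
  have hidem := (isIdempotentElem_omegaPow s).map φ
  rw [hn, map_spow] at hidem ⊢
  exact (omegaPow_eq hidem).symm

theorem isCompletelyRegular_of_omegaPow_mul_eq {c : S} (hc : omegaPow c * c = c) :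
    IsCompletelyRegular c := by
  obtain ⟨n, hn⟩ := exists_omegaPow_eq_spow c
  have hcomm : c * spow c (n + n) = spow c (n + n + 1) := by
    simpa only [spow, zero_add] using spow_mul_spow c 0 (n + n)
  refine ⟨spow c (n + n), ?_, hcomm⟩
  rw [hcomm, ← spow_mul_spow, ← hn, (isIdempotentElem_omegaPow c).eq, hc]

end OmegaPower

section Pseudovariety

variable {U T : Semigrp.{u}}

theorem V1.isSandwichRegular (hU : V1 U) : IsSandwichRegular U := by
  obtain ⟨_, hV⟩ := hU
  intro e x f he hf
  have hVexf := hV e x f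
  rw [omegaPow_eq (n := 0) he, omegaPow_eq (n := 0) hf] at hVexf
  exact isCompletelyRegular_of_omegaPow_mul_eq hVexf

theorem V1.of_surjective (hU : V1 U) {φ : U →ₙ* T} (hφ : Surjective φ) :
    V1 T := by
  obtain ⟨_, hV⟩ := hU
  have : Finite T := Finite.of_surjective φ hφ
  refine ⟨this, hφ.forall₃.2 fun t x z => ?_⟩
  simp only [← map_omegaPow, ← map_mul, hV]

theorem V1.surjective_of_dominion_srange_eq_univ {S : Type u} [Semigroup S] (hU : V1 U)
    {φ : U →ₙ* S} (hφ : dominion φ.srange = Set.univ) : Surjective φ :=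
  have : Finite U := hU.1
  SemigroupEpi.surjective_of_dominion_srange_eq_univ hU.isSandwichRegular hφ

theorem dominion_srange_eq_univ_of_epi (α : U ⟶ T) [Epi α] :
    dominion (MulHom.srange α.hom) = Set.univ := by
  refine Set.eq_univ_of_forall fun d V _ β γ hβγ => ?_
  have hcomp : α ≫ Semigrp.ofHom β = α ≫ Semigrp.ofHom γ := by
    ext s
    exact hβγ _ ⟨s, rfl⟩
  exact congrArg (fun δ => δ.hom d) ((cancel_epi α).1 hcomp)

end Pseudovariety

end SemigroupEpi

theorem theoremt :
    SemigroupEpi.IsSaturatedClass SemigroupEpi.V1.{u} ∧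
      SemigroupEpi.IsEpimorphicallyClosed SemigroupEpi.V1.{u} := by
  constructor
  · intro U hU S _ φ _ hne hdom
    exact hne (MulHom.srange_eq_top_iff_surjective.2
      (hU.surjective_of_dominion_srange_eq_univ hdom))
  · intro S T α _ hS
    exact hS.of_surjective (hS.surjective_of_dominion_srange_eq_univ
      (SemigroupEpi.dominion_srange_eq_univ_of_epi α))
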